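/- Let $G$ be a locally compact (Hausdorff) group with a left Haar measure $\lambda_G$ (a non-zero left-invariant Radon measure), and suppose that $G$ is amenable, i.e. that there is a left-invariant mean on $L^\infty(G)$. Let $K$ be a compact subgroup of $G$. A function $f$ on $G$ is called $K$-bi-invariant if $f(kgk')=f(g)$ for all $g\in G$ and $k,k'\in K$; a subset of $G$ is called $K$-bi-invariant if its characteristic function is, and symmetric if it is equal to the set of inverses of its elements. A function $f:G\to\mathbb{C}$ is called positive definite if $\sum_{i=1}^n\sum_{j=1}^n c_i\overline{c_j}f(g_i^{-1}g_j)\ge 0$ for all $n\in\mathbb{N}$, $c_1,\dots,c_n\in\mathbb{C}$ and $g_1,\dots,g_n\in G$. Let $U\subset G$ be a closed, $K$-bi-invariant, symmetric neighbourhood of the identity $e$ with $\lambda_G(U)<\infty$, and let $V\subset G$ be a closed, $K$-bi-invariant, symmetric set. Let $\mathcal{F}_G^K(U,V)$ be the class of all continuous positive definite $K$-bi-invariant functions $\varphi:G\to\mathbb{R}$ with $\varphi(e)=1$, $\operatorname{supp}\varphi_+\subset U$ and $\operatorname{supp}\varphi_-\subset V$, where $\varphi_+=\max\{\varphi,0\}$,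 $\varphi_-=\max\{-\varphi,0\}$ and $\operatorname{supp}$ denotes the closed support, and let $$\mathcal{C}_G^K(U,V):=\sup_{\varphi\in\mathcal{F}_G^K(U,V)}\int_G\varphi\,\mathrm{d}\lambda_G ,$$ where $\int_G\varphi\,\mathrm{d}\lambda_G=\int_G\varphi_+\,\mathrm{d}\lambda_G-\int_G\varphi_-\,\mathrm{d}\lambda_G\in[-\infty,\infty)$, which makes sense since $\varphi_+\le\mathbf{1}_U$. Then the supremum is attained: there is an integrable function $\varphi\in\mathcal{F}_G^K(U,V)$ such that $\int_G\varphi\,\mathrm{d}\lambda_G=\mathcal{C}_G^K(U,V)$. -/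

import Mathlib

open MeasureTheory
open scoped ENNReal Pointwise ComplexOrder

namespace Delsarte

/-- A locally compact group `G` with left Haar measure `μ` is amenable if there is a left-invariant
mean on `L^∞(G)`: a positive, normalised linear functional that is invariant under left
translations `f ↦ f (g * ·)`. -/
def IsAmenable {G : Type*} [Group G] [TopologicalSpace G] [IsTopologicalGroup G]
    [MeasurableSpace G] [BorelSpace G] (μ : Measure G) [μ.IsHaarMeasure] : Prop :=
  ∃ m : Lp ℝ ∞ μ →ₗ[ℝ] ℝ,
    (∀ f : Lp ℝ ∞ μ, 0 ≤ f → 0 ≤ m f) ∧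
    m ((memLp_top_const (1 : ℝ)).toLp (fun _ : G => (1 : ℝ))) = 1 ∧
    ∀ (g : G) (f : Lp ℝ ∞ μ),
      m (Lp.compMeasurePreserving (fun x => g * x) (measurePreserving_mul_left μ g) f) = m f

/-- Positive definite functions on a group. The inequality in `ℂ` says that the sum is a
non-negative real number. -/
def IsPositiveDefinite {G : Type*} [Group G] (f : G → ℂ) : Prop :=
  ∀ (n : ℕ) (c : Fin n → ℂ) (g : Fin n → G),
    0 ≤ ∑ i, ∑ j, c i * (starRingEnd ℂ) (c j) * f ((g i)⁻¹ * g j)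

/-- `f (k g k') = f g` for all `g ∈ G` and `k, k' ∈ K`. -/
def IsBiInvariant {G α : Type*} [Group G] (K : Subgroup G) (f : G → α) : Prop :=
  ∀ k ∈ K, ∀ k' ∈ K, ∀ g : G, f (k * g * k') = f g

/-- A set is `K`-bi-invariant if its characteristic function is. -/
def IsBiInvariantSet {G : Type*} [Group G] (K : Subgroup G) (U : Set G) : Prop :=
  ∀ k ∈ K, ∀ k' ∈ K, ∀ g : G, k * g * k' ∈ U ↔ g ∈ U

/-- The class `F_G^K(U,V)` of real-valued continuous positive definite `K`-bi-invariant functions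
`φ` with `φ(e) = 1`, `supp φ₊ ⊆ U` and `supp φ₋ ⊆ V`. -/
def delsarteClass {G : Type*} [Group G] [TopologicalSpace G] (K : Subgroup G) (U V : Set G) :
    Set (G → ℝ) :=
  {φ | Continuous φ ∧ IsPositiveDefinite (fun g => (φ g : ℂ)) ∧ IsBiInvariant K φ ∧ φ 1 = 1 ∧
    tsupport (fun g => max (φ g) 0) ⊆ U ∧ tsupport (fun g => max (-φ g) 0) ⊆ V}

/-- The integral `∫ φ₊ dμ - ∫ φ₋ dμ` as an extended real number. It is the true value whenever one
of the two integrals is finite; for `φ ∈ F_G^K(U,V)` with `μ U < ∞` the first one is, as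
`φ₊ ≤ 1_U`. -/
noncomputable def extIntegral {G : Type*} [MeasurableSpace G] (μ : Measure G) (φ : G → ℝ) : EReal :=
  ((∫⁻ g, ENNReal.ofReal (φ g) ∂μ : ℝ≥0∞) : EReal)
    - ((∫⁻ g, ENNReal.ofReal (-φ g) ∂μ : ℝ≥0∞) : EReal)

/-- The Delsarte constant `C_G^K(U,V)`: the supremum of `∫ φ dμ` over `φ ∈ F_G^K(U,V)`. -/
noncomputable def delsarteConstant {G : Type*} [Group G] [TopologicalSpace G] [MeasurableSpace G]
    (μ : Measure G) (K : Subgroup G) (U V : Set G) : EReal :=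
  ⨆ φ ∈ delsarteClass K U V, extIntegral μ φ

end Delsarte

-- Members of the class satisfy `φ ≤ 1_U` and `φ² ≤ |φ| ≤ 2·1_U - φ`, so those with integral near
-- the supremum `C` are bounded in `L²`. They form decreasing convex sets; choosing elements of
-- almost minimal norm and using the parallelogram law gives a strongly convergent maximising
-- sequence. Along an a.e. convergent subsequence, Fatou's lemma for `1_U - φₙ ≥ 0` shows that the
-- limit is integrable with integral at least `C`.
--
-- The main difficulty is that the limit `Ψ` is only an `L²` class and needs a continuous positive
-- definite representative (`exists_continuous_positiveDefinite_ae_eq`). Positive definiteness is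
-- encoded by the form `∫∫ f(y) h(z) Ψ(y⁻¹z)`, together with the bound of squared coefficients by
-- the form (`IsPositiveDefinite.form_props`), which is stable under `L²` limits. Approximate Riesz
-- vectors `F j` for `h ↦ ∫ h Ψ` then act as an approximate identity: their coefficients converge
-- uniformly, and the limit is the representative.
--
-- Only `ψ 1 ≤ 1` survives the limit. Since an autocorrelation function in the class shows `C > 0`,
-- the limit is non-zero, so `ψ 1 > 0`, and dividing by `ψ 1` does not lower the integral.
-- Non-integrable members have integral `-∞` and do not compete.

universe u

namespace Delsarte

open Filter Topology CompactlySupported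

/-! ### Positive definite functions and their feature maps. -/

section PositiveDefinite

variable {G : Type*} [Group G]

theorem IsPositiveDefinite.apply_inv {φ : G → ℝ}
    (h : IsPositiveDefinite (fun g => (φ g : ℂ))) (x : G) : φ x⁻¹ = φ x := by
  -- With these coefficients the sum is `2 φ(1) + i (φ(x⁻¹) - φ(x))`, whose imaginary part must
  -- vanish.
  have h2 := h 2 ![1, Complex.I] ![1, x]
  simp only [Fin.sum_univ_two] at h2
  have h3 := (Complex.le_def.1 h2).2
  simp at h3
  linarith

theorem IsPositiveDefinite.real_sum_nonneg {φ : G → ℝ}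
    (h : IsPositiveDefinite (fun g => (φ g : ℂ))) (n : ℕ) (c : Fin n → ℝ) (g : Fin n → G) :
    0 ≤ ∑ i, ∑ j, c i * c j * φ ((g i)⁻¹ * g j) := by
  have h2 := h n (fun i => (c i : ℂ)) g
  simp only [Complex.conj_ofReal] at h2
  exact_mod_cast h2

/-- An even real function with positive semidefinite real matrices `φ (gᵢ⁻¹ gⱼ)` is positive
definite. -/
theorem isPositiveDefinite_of_real {φ : G → ℝ} (he : ∀ x, φ x⁻¹ = φ x)
    (h : ∀ (n : ℕ) (c : Fin n → ℝ) (g : Fin n → G),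
      0 ≤ ∑ i, ∑ j, c i * c j * φ ((g i)⁻¹ * g j)) :
    IsPositiveDefinite (fun g => (φ g : ℂ)) := by
  intro n c g
  have hsymm : ∀ i j, φ ((g i)⁻¹ * g j) = φ ((g j)⁻¹ * g i) := fun i j => by
    rw [← he, mul_inv_rev, inv_inv]
  rw [Complex.le_def]
  constructor
  · have h1 := h n (fun i => (c i).re) g
    have h2 := h n (fun i => (c i).im) g
    refine (add_nonneg h1 h2).trans_eq ?_
    simp only [Complex.re_sum, ← Finset.sum_add_distrib]
    refine Finset.sum_congr rfl fun i _ => Finset.sum_congr rfl fun j _ => ?_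
    simp
    ring
  · have hswap : ∑ i, ∑ j, (c i).im * (c j).re * φ ((g i)⁻¹ * g j)
        = ∑ i, ∑ j, (c i).re * (c j).im * φ ((g i)⁻¹ * g j) := by
      rw [Finset.sum_comm]
      refine Finset.sum_congr rfl fun i _ => Finset.sum_congr rfl fun j _ => ?_
      rw [hsymm]
      ring
    simp only [Complex.im_sum, Complex.zero_im]
    rw [← sub_eq_zero.2 hswap, ← Finset.sum_sub_distrib]
    refine Finset.sum_congr rfl fun i _ => ?_
    rw [← Finset.sum_sub_distrib]
    refine Finset.sum_congr rfl fun j _ => ?_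
    simp
    ring

theorem IsPositiveDefinite.finset_sum_nonneg {φ : G → ℝ}
    (h : IsPositiveDefinite (fun g => (φ g : ℂ))) (s : Finset G) (c : G → ℝ) :
    0 ≤ ∑ x ∈ s, ∑ y ∈ s, c x * c y * φ (x⁻¹ * y) := by
  have h1 := h.real_sum_nonneg s.card (fun i => c (s.equivFin.symm i))
    (fun i => (s.equivFin.symm i : G))
  refine h1.trans_eq ?_
  rw [← Finset.sum_coe_sort s, ← s.equivFin.symm.sum_comp]
  refine Finset.sum_congr rfl fun i _ => ?_
  rw [← Finset.sum_coe_sort s, ← s.equivFin.symm.sum_comp]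

end PositiveDefinite

/-- A real positive definite function is a matrix coefficient: it admits a feature map into a
Hilbert space. -/
theorem IsPositiveDefinite.exists_featureMap {G : Type u} [Group G] {φ : G → ℝ}
    (h : IsPositiveDefinite (fun g => (φ g : ℂ))) :
    ∃ (H : Type u) (_ : NormedAddCommGroup H) (_ : InnerProductSpace ℝ H) (_ : CompleteSpace H)
      (v : G → H), ∀ x y, inner ℝ (v x) (v y) = φ (x⁻¹ * y) := by
  classical
  -- The scalar kernel is viewed as operator-valued on `ℝ`; the feature vectors are the kernel
  -- functions of its reproducing kernel Hilbert space.
  let k : Matrix G G (ℝ →L[ℝ] ℝ) := Matrix.of fun x y => φ (x⁻¹ * y) • ContinuousLinearMap.id ℝ ℝ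
  have hsymm : ∀ x y, φ (x⁻¹ * y) = φ (y⁻¹ * x) := fun x y => by
    rw [← h.apply_inv, mul_inv_rev, inv_inv]
  have hk : k.PosSemidef := by
    refine ((RKHS.posSemidef_tfae (K := k)).out 0 2).2 ?_
    refine ⟨?_, fun vv => ?_⟩
    · ext x y
      simp [k, Matrix.conjTranspose_apply, hsymm x y, ContinuousLinearMap.star_eq_adjoint,
        ContinuousLinearMap.adjoint_id]
    · refine (h.finset_sum_nonneg vv.support vv).trans_eq ?_
      simp only [Finsupp.sum, k, Matrix.of_apply]
      simp
      refine Finset.sum_congr rfl fun i _ => Finset.sum_congr rfl fun j _ => ?_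
      rw [hsymm]
      ring
  have : Fact k.PosSemidef := ⟨hk⟩
  refine ⟨RKHS.OfKernel k, inferInstance, inferInstance, inferInstance,
    fun x => RKHS.kerFun (RKHS.OfKernel k) x 1, fun x y => ?_⟩
  rw [← RKHS.kernel_inner, RKHS.OfKernel.kernel_ofKernel]
  simp [k, hsymm]

/-! ### Two variational lemmas in (pre-)Hilbert spaces. -/

/-- Approximate Riesz representation for a positive semidefinite form on a real vector space. -/
theorem exists_approx_riesz {E : Type*} [AddCommGroup E] [Module ℝ E]
    (B : E →ₗ[ℝ] E →ₗ[ℝ] ℝ) (L : E →ₗ[ℝ] ℝ) (hsymm : ∀ f h, B f h = B h f)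
    (hL : ∀ f, L f ^ 2 ≤ B f f) {ε : ℝ} (hε : 0 < ε) :
    ∃ f, ∀ h, (B f h - L h) ^ 2 ≤ ε * B h h := by
  -- A minimiser of `J` would represent `L`. As `E` need not be complete, an `ε`-minimiser has to
  -- do; `J ≥ L² - 2L ≥ -1` bounds it below.
  let J : E → ℝ := fun f => B f f - 2 * L f
  have hbdd : BddBelow (Set.range J) := by
    refine ⟨-1, ?_⟩
    rintro _ ⟨f, rfl⟩
    have := hL f
    simp only [J]
    nlinarith [sq_nonneg (L f - 1)]
  obtain ⟨_, ⟨f, rfl⟩, hf⟩ := exists_lt_of_csInf_lt (Set.range_nonempty J)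
    (lt_add_of_pos_right (sInf (Set.range J)) hε)
  refine ⟨f, fun h => ?_⟩
  -- Perturbing `f` to `f + t h` lowers `J` by at most `ε`; the discriminant of this quadratic in
  -- `t` gives the claim.
  have key : ∀ t : ℝ, 0 ≤ B h h * (t * t) + (2 * (B f h - L h)) * t + ε := fun t => by
    have h1 : sInf (Set.range J) ≤ J (f + t • h) := csInf_le hbdd ⟨_, rfl⟩
    have h2 : J (f + t • h) = J f + (B h h * (t * t) + (2 * (B f h - L h)) * t) := by
      simp only [J, map_add, map_smul, LinearMap.add_apply, LinearMap.smul_apply, smul_eq_mul,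
        hsymm h f]
      ring
    linarith
  have := discrim_le_zero key
  rw [discrim] at this
  nlinarith

/-- A decreasing sequence of nonempty, uniformly bounded convex subsets of a Hilbert space admits a
convergent sequence of representatives. -/
theorem exists_seq_tendsto_of_antitone_convex {E : Type*} [NormedAddCommGroup E]
    [InnerProductSpace ℝ E] [CompleteSpace E] {A : ℕ → Set E} (hA : Antitone A)
    (hne : ∀ n, (A n).Nonempty) (hconv : ∀ n, Convex ℝ (A n)) {C : ℝ}
    (hC : ∀ n, ∀ x ∈ A n, ‖x‖ ^ 2 ≤ C) :
    ∃ (x : ℕ → E) (y : E), (∀ n, x n ∈ A n) ∧ Filter.Tendsto x Filter.atTop (nhds y) := by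
  let d : ℕ → ℝ := fun n => sInf ((fun x => ‖x‖ ^ 2) '' A n)
  have hbdd : ∀ n, BddBelow ((fun x => ‖x‖ ^ 2) '' A n) := fun n =>
    ⟨0, by rintro _ ⟨x, -, rfl⟩; positivity⟩
  have hd_le : ∀ n, ∀ x ∈ A n, d n ≤ ‖x‖ ^ 2 := fun n x hx => csInf_le (hbdd n) ⟨x, hx, rfl⟩
  have hd_mono : Monotone d := fun m n hmn =>
    csInf_le_csInf (hbdd m) ((hne n).image _) (Set.image_mono (hA hmn))
  have hd_bdd : BddAbove (Set.range d) := by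
    refine ⟨C, ?_⟩
    rintro _ ⟨n, rfl⟩
    obtain ⟨x, hx⟩ := hne n
    exact (hd_le n x hx).trans (hC n x hx)
  have hex : ∀ n : ℕ, ∃ x ∈ A n, ‖x‖ ^ 2 < d n + 1 / ((n : ℝ) + 1) := fun n => by
    obtain ⟨_, ⟨x, hx, rfl⟩, hlt⟩ := exists_lt_of_csInf_lt ((hne n).image (fun x => ‖x‖ ^ 2))
      (lt_add_of_pos_right (d n) (Nat.one_div_pos_of_nat (α := ℝ) (n := n)))
    exact ⟨x, hx, hlt⟩
  choose x hx hxd using hex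
  have hlim := tendsto_atTop_ciSup hd_mono hd_bdd
  set D := ⨆ n, d n
  have hdD : ∀ n, d n ≤ D := fun n => le_ciSup hd_bdd n
  -- The midpoint lies in `A n`, so its squared norm is at least `d n`; the parallelogram law then
  -- bounds the distance.
  have key : ∀ n m, n ≤ m → ‖x n - x m‖ ^ 2 ≤ 4 * (D - d n + 1 / ((n : ℝ) + 1)) := by
    intro n m hnm
    have hmid : (1 / 2 : ℝ) • x n + (1 / 2 : ℝ) • x m ∈ A n :=
      hconv n (hx n) (hA hnm (hx m)) (by norm_num) (by norm_num) (by norm_num)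
    have h1 := hd_le n _ hmid
    rw [← smul_add, norm_smul, mul_pow] at h1
    have h2 := parallelogram_law_with_norm ℝ (x n) (x m)
    have h3 : 1 / ((m : ℝ) + 1) ≤ 1 / ((n : ℝ) + 1) := by gcongr
    have h4 := hxd n
    have h5 := hxd m
    have h6 := hdD n
    have h7 := hdD m
    norm_num at h1
    nlinarith
  have hlim2 : Filter.Tendsto (fun n : ℕ => Real.sqrt (4 * (D - d n + 1 / ((n : ℝ) + 1))))
      Filter.atTop (nhds 0) := by
    have := ((hlim.const_sub D).add (tendsto_one_div_add_atTop_nhds_zero_nat (𝕜 := ℝ))).const_mul 4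
    simpa using this.sqrt
  have hcauchy : CauchySeq x := by
    refine cauchySeq_of_le_tendsto_0' _ (fun n m hnm => ?_) hlim2
    rw [dist_eq_norm]
    exact Real.le_sqrt_of_sq_le (key n m hnm)
  obtain ⟨y, hy⟩ := cauchySeq_tendsto_of_complete hcauchy
  exact ⟨x, y, hx, hy⟩

/-! ### The convolution form and coefficients of an `L²` class. -/

section Forms

set_option linter.unusedSectionVars false

variable {G : Type u} [Group G] [TopologicalSpace G] [IsTopologicalGroup G]
  [MeasurableSpace G] [BorelSpace G] (μ : Measure G) [μ.IsHaarMeasure]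

theorem inner_domMulAct_smul (c : Gᵈᵐᵃ) (a b : Lp ℝ 2 μ) :
    inner ℝ (c • a) (c • b) = inner ℝ a b := by
  rw [real_inner_eq_norm_add_mul_self_sub_norm_mul_self_sub_norm_mul_self_div_two,
    real_inner_eq_norm_add_mul_self_sub_norm_mul_self_sub_norm_mul_self_div_two,
    ← smul_add, DomMulAct.norm_smul_Lp, DomMulAct.norm_smul_Lp, DomMulAct.norm_smul_Lp]

theorem memLp_compactlySupported (f : C_c(G, ℝ)) (p : ℝ≥0∞) : MemLp f p μ :=
  f.continuous.memLp_of_hasCompactSupport f.hasCompactSupport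

theorem integrable_compactlySupported_mul (f : C_c(G, ℝ)) {w : G → ℝ} (hw : Continuous w) :
    Integrable (fun y => f y * w y) μ :=
  (f.continuous.mul hw).integrable_of_hasCompactSupport f.hasCompactSupport.mul_right

/-- A compactly supported continuous function as an element of `L²`. -/
noncomputable def ccLp : C_c(G, ℝ) →ₗ[ℝ] Lp ℝ 2 μ where
  toFun f := (memLp_compactlySupported μ f 2).toLp f
  map_add' _ _ := rfl
  map_smul' _ _ := rfl

theorem coeFn_ccLp (f : C_c(G, ℝ)) : ccLp μ f =ᵐ[μ] f :=
  (memLp_compactlySupported μ f 2).coeFn_toLp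

/-- Left translation `z ↦ f (g⁻¹ z)`. -/
noncomputable def leftTranslate (g : G) (f : C_c(G, ℝ)) : C_c(G, ℝ) where
  toFun z := f (g⁻¹ * z)
  continuous_toFun := f.continuous.comp (continuous_const_mul g⁻¹)
  hasCompactSupport' := f.hasCompactSupport.comp_homeomorph (Homeomorph.mulLeft g⁻¹)

@[simp]
theorem leftTranslate_apply (g : G) (f : C_c(G, ℝ)) (z : G) :
    leftTranslate g f z = f (g⁻¹ * z) := rfl

theorem ccLp_leftTranslate (g : G) (f : C_c(G, ℝ)) :
    ccLp μ (leftTranslate g f) = DomMulAct.mk g⁻¹ • ccLp μ f := rfl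

variable [LocallyCompactSpace G] {μ} [μ.Regular]

/-- The convolution-type coefficient `y ↦ ∫ h(z) Ψ(y⁻¹ z) dz`. -/
noncomputable def coef (Ψ : Lp ℝ 2 μ) (h : C_c(G, ℝ)) (y : G) : ℝ :=
  inner ℝ (ccLp μ h) (DomMulAct.mk y⁻¹ • Ψ)

theorem continuous_coef (Ψ : Lp ℝ 2 μ) (h : C_c(G, ℝ)) : Continuous (coef Ψ h) := by
  unfold coef
  have : Fact ((2 : ℝ≥0∞) ≠ ∞) := ⟨by simp⟩
  have h1 : Continuous fun y : G => DomMulAct.mk y⁻¹ • Ψ :=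
    (DomMulAct.continuous_mk.comp continuous_inv).smul continuous_const
  exact continuous_const.inner h1

theorem coef_add (Ψ : Lp ℝ 2 μ) (h h' : C_c(G, ℝ)) (y : G) :
    coef Ψ (h + h') y = coef Ψ h y + coef Ψ h' y := by
  simp [coef, inner_add_left]

theorem coef_smul (Ψ : Lp ℝ 2 μ) (c : ℝ) (h : C_c(G, ℝ)) (y : G) :
    coef Ψ (c • h) y = c * coef Ψ h y := by
  simp [coef, inner_smul_left]

theorem abs_coef_sub_coef_le (Ψ Ψ' : Lp ℝ 2 μ) (h : C_c(G, ℝ)) (y : G) :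
    |coef Ψ h y - coef Ψ' h y| ≤ ‖ccLp μ h‖ * ‖Ψ - Ψ'‖ := by
  rw [coef, coef, ← inner_sub_right, ← smul_sub]
  refine (abs_real_inner_le_norm _ _).trans ?_
  rw [DomMulAct.norm_smul_Lp]

theorem coef_leftTranslate (Ψ : Lp ℝ 2 μ) (g : G) (h : C_c(G, ℝ)) (y : G) :
    coef Ψ (leftTranslate g h) y = coef Ψ h (g⁻¹ * y) := by
  rw [coef, coef, ccLp_leftTranslate, ← inner_domMulAct_smul μ (DomMulAct.mk g), smul_smul,
    smul_smul, ← DomMulAct.mk_mul, ← DomMulAct.mk_mul]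
  simp

/-- The form `∫∫ f(y) h(z) Ψ(y⁻¹ z) dz dy`. -/
noncomputable def form (Ψ : Lp ℝ 2 μ) : C_c(G, ℝ) →ₗ[ℝ] C_c(G, ℝ) →ₗ[ℝ] ℝ :=
  LinearMap.mk₂ ℝ (fun f h => ∫ y, f y * coef Ψ h y ∂μ)
    (fun f f' h => by
      rw [← integral_add (integrable_compactlySupported_mul μ f (continuous_coef Ψ h))
        (integrable_compactlySupported_mul μ f' (continuous_coef Ψ h))]
      simp [add_mul])
    (fun c f h => by simp [mul_assoc, integral_const_mul])
    (fun f h h' => by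
      rw [← integral_add (integrable_compactlySupported_mul μ f (continuous_coef Ψ h))
        (integrable_compactlySupported_mul μ f (continuous_coef Ψ h'))]
      simp [coef_add, mul_add])
    (fun c f h => by simp [coef_smul, mul_left_comm, integral_const_mul])

theorem form_apply (Ψ : Lp ℝ 2 μ) (f h : C_c(G, ℝ)) :
    form Ψ f h = ∫ y, f y * coef Ψ h y ∂μ := rfl

/-- Evaluation of the coefficient at the identity, `h ↦ ∫ h Ψ`. -/
noncomputable def pairing (Ψ : Lp ℝ 2 μ) : C_c(G, ℝ) →ₗ[ℝ] ℝ where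
  toFun h := coef Ψ h 1
  map_add' h h' := coef_add Ψ h h' 1
  map_smul' c h := coef_smul Ψ c h 1

theorem pairing_apply (Ψ : Lp ℝ 2 μ) (h : C_c(G, ℝ)) : pairing Ψ h = coef Ψ h 1 := rfl

theorem pairing_eq_integral (Ψ : Lp ℝ 2 μ) (h : C_c(G, ℝ)) :
    pairing Ψ h = ∫ z, h z * Ψ z ∂μ := by
  rw [pairing_apply, coef, inv_one, DomMulAct.mk_one, one_smul, L2.inner_def]
  refine integral_congr_ae ?_
  filter_upwards [coeFn_ccLp μ h] with z hz
  simp [hz, mul_comm]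

theorem form_leftTranslate (Ψ : Lp ℝ 2 μ) (g : G) (f h : C_c(G, ℝ)) :
    form Ψ (leftTranslate g f) (leftTranslate g h) = form Ψ f h := by
  simp only [form_apply, coef_leftTranslate, leftTranslate_apply]
  exact integral_mul_left_eq_self (fun y => f y * coef Ψ h y) g⁻¹

theorem tendsto_coef {P : ℕ → Lp ℝ 2 μ} {Ψ : Lp ℝ 2 μ} (hP : Tendsto P atTop (𝓝 Ψ))
    (h : C_c(G, ℝ)) (y : G) : Tendsto (fun n => coef (P n) h y) atTop (𝓝 (coef Ψ h y)) :=
  tendsto_const_nhds.inner (hP.const_smul _)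

/-- Translations are isometries of `L²`, so the coefficients converge uniformly and the error is at
most `‖f‖₁ ‖h‖₂ ‖P n - Ψ‖₂`. -/
theorem tendsto_form {P : ℕ → Lp ℝ 2 μ} {Ψ : Lp ℝ 2 μ} (hP : Tendsto P atTop (𝓝 Ψ))
    (f h : C_c(G, ℝ)) : Tendsto (fun n => form (P n) f h) atTop (𝓝 (form Ψ f h)) := by
  rw [tendsto_iff_norm_sub_tendsto_zero]
  have h0 := (tendsto_iff_norm_sub_tendsto_zero.1 hP).const_mul ((∫ y, |f y| ∂μ) * ‖ccLp μ h‖)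
  rw [mul_zero] at h0
  refine squeeze_zero (fun _ => norm_nonneg _) (fun n => ?_) h0
  rw [form_apply, form_apply,
    ← integral_sub (integrable_compactlySupported_mul μ f (continuous_coef _ h))
      (integrable_compactlySupported_mul μ f (continuous_coef _ h)), mul_assoc,
    ← integral_mul_const]
  refine norm_integral_le_of_norm_le
    ((memLp_one_iff_integrable.1 (memLp_compactlySupported μ f 1)).abs.mul_const _) (ae_of_all _ fun y => ?_)
  rw [← mul_sub, Real.norm_eq_abs, abs_mul]
  exact mul_le_mul_of_nonneg_left (abs_coef_sub_coef_le _ _ _ _) (abs_nonneg _)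

theorem coef_toLp {φ : G → ℝ} (hφ : MemLp φ 2 μ) (h : C_c(G, ℝ)) (y : G) :
    coef (hφ.toLp φ) h y = ∫ z, h z * φ (y⁻¹ * z) ∂μ := by
  rw [coef, DomMulAct.mk_smul_toLp, L2.inner_def]
  refine integral_congr_ae ?_
  filter_upwards [coeFn_ccLp μ h,
    (hφ.comp_measurePreserving (measurePreserving_smul y⁻¹ μ)).coeFn_toLp] with z hz hz'
  have hz2 : MemLp.toLp _ (hφ.comp_measurePreserving (measurePreserving_smul y⁻¹ μ)) z
    = φ (y⁻¹ * z) := hz'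
  rw [hz]
  exact (congrArg (inner ℝ (h z)) hz2).trans (by simp [mul_comm])

/-- For a continuous positive definite square integrable function, the form is symmetric and
dominates the squares of the coefficients. -/
theorem IsPositiveDefinite.form_props {φ : G → ℝ} (hpd : IsPositiveDefinite (fun g => (φ g : ℂ)))
    (hcont : Continuous φ) (h1 : φ 1 = 1) (hφ : MemLp φ 2 μ) :
    (∀ f h, form (hφ.toLp φ) f h = form (hφ.toLp φ) h f) ∧
      ∀ f y, coef (hφ.toLp φ) f y ^ 2 ≤ form (hφ.toLp φ) f f := by
  obtain ⟨H, _, _, _, v, hv⟩ := hpd.exists_featureMap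
  have hvn : ∀ x, ‖v x‖ = 1 := fun x => by
    have := real_inner_self_eq_norm_sq (v x)
    rw [hv, inv_mul_cancel, h1] at this
    exact (pow_eq_one_iff_of_nonneg (norm_nonneg _) two_ne_zero).1 this.symm
  have hvc : Continuous v := by
    rw [continuous_iff_continuousAt]
    intro x
    rw [ContinuousAt, tendsto_iff_norm_sub_tendsto_zero]
    have h2 : ∀ y, ‖v y - v x‖ = Real.sqrt (2 - 2 * φ (y⁻¹ * x)) := fun y => by
      rw [eq_comm, ← Real.sqrt_sq (norm_nonneg (v y - v x)), norm_sub_sq_real, hvn, hvn, hv]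
      ring_nf
    simp only [h2]
    have h3 : Continuous fun y => Real.sqrt (2 - 2 * φ (y⁻¹ * x)) := by fun_prop
    simpa [h1] using h3.tendsto x
  -- Smearing the feature map turns the form into the Gram form of `w` and the coefficient at `y`
  -- into the inner product with the unit vector `v y`; domination is then Cauchy–Schwarz.
  let w : C_c(G, ℝ) → H := fun h => ∫ z, h z • v z ∂μ
  have hint : ∀ h : C_c(G, ℝ), Integrable (fun z => h z • v z) μ := fun h =>
    (h.continuous.smul hvc).integrable_of_hasCompactSupport h.hasCompactSupport.smul_right
  have hcoef : ∀ h y, coef (hφ.toLp φ) h y = inner ℝ (v y) (w h) := fun h y => by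
    rw [coef_toLp, ← integral_inner (hint h)]
    simp [inner_smul_right, hv]
  have hform : ∀ f h, form (hφ.toLp φ) f h = inner ℝ (w f) (w h) := fun f h => by
    rw [form_apply, real_inner_comm, ← integral_inner (hint f)]
    simp [hcoef, inner_smul_right, real_inner_comm]
  refine ⟨fun f h => by rw [hform, hform, real_inner_comm], fun f y => ?_⟩
  rw [hform, hcoef, real_inner_self_eq_norm_sq, ← sq_abs]
  have := abs_real_inner_le_norm (v y) (w f)
  rw [hvn, one_mul] at this
  gcongr

end Forms

/-! ### Continuous representatives of positive definite `L²` classes. -/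

section Representative

variable {G : Type u} [Group G] [TopologicalSpace G] [IsTopologicalGroup G]
  [LocallyCompactSpace G] [T2Space G] [MeasurableSpace G] [BorelSpace G]
  {μ : Measure G} [μ.IsHaarMeasure] [μ.Regular]

/-- Outer regularity and Urysohn functions approximate the indicator of `t` in `L²` by elements of
`C_c`, all orthogonal to `W`. -/
theorem setIntegral_eq_zero_of_pairing_eq_zero {W : Lp ℝ 2 μ} (hW : ∀ h, pairing W h = 0)
    {t : Set G} (ht : IsCompact t) : ∫ x in t, W x ∂μ = 0 := by
  have hinner : ∀ h, inner ℝ (ccLp μ h) W = 0 := fun h => by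
    simpa [pairing_apply, coef] using hW h
  have htm := ht.measurableSet
  have htf : μ t ≠ ∞ := ht.measure_ne_top
  have key : ∀ ε : ℝ, 0 < ε → |∫ x in t, W x ∂μ| ≤ ε * ‖W‖ := by
    intro ε hε
    obtain ⟨O, htO, hO, hOf, hOt⟩ := htm.exists_isOpen_sdiff_lt htf
      (ε := ENNReal.ofReal (ε ^ 2)) (by simpa using hε.ne')
    obtain ⟨f', hf1, hf0, hfc, hf01⟩ := exists_continuous_one_zero_of_isCompact ht
      hO.isClosed_compl (Set.disjoint_compl_right_iff_subset.2 htO)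
    let f : C_c(G, ℝ) := ⟨f', hfc⟩
    have hdm : MeasurableSet (O \ t) := hO.measurableSet.diff htm
    have hdf : μ (O \ t) ≠ ∞ := ne_top_of_lt hOt
    have hnorm : ‖indicatorConstLp 2 htm htf (1 : ℝ) - ccLp μ f‖ ≤ ε := by
      refine (Lp.norm_le_norm_of_ae_le (g := indicatorConstLp 2 hdm hdf (1 : ℝ)) ?_).trans ?_
      · filter_upwards [Lp.coeFn_sub (indicatorConstLp 2 htm htf (1 : ℝ)) (ccLp μ f),
          coeFn_ccLp μ f, indicatorConstLp_coeFn (p := 2) (hs := htm) (hμs := htf) (c := (1 : ℝ)),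
          indicatorConstLp_coeFn (p := 2) (hs := hdm) (hμs := hdf) (c := (1 : ℝ))]
          with x h1 h2 h3 h4
        rw [h1, Pi.sub_apply, h2, h3, h4]
        have hfx : f x = f' x := rfl
        by_cases hxt : x ∈ t
        · simp [hxt, hfx, hf1 hxt]
        · by_cases hxO : x ∈ O
          · simp [hxt, hxO, hfx, abs_le]
            exact ⟨by linarith [(hf01 x).1], (hf01 x).2⟩
          · simp [hxt, hxO, hfx, hf0 hxO]
      · rw [norm_indicatorConstLp two_ne_zero (by simp)]
        have h5 : μ.real (O \ t) ≤ ε ^ 2 :=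
          ENNReal.toReal_le_of_le_ofReal (sq_nonneg ε) hOt.le
        have h6 := Real.sqrt_le_sqrt h5
        rw [Real.sqrt_sq hε.le, Real.sqrt_eq_rpow] at h6
        simpa using h6
    rw [← L2.inner_indicatorConstLp_one htm htf W, ← sub_zero (inner ℝ _ W), ← hinner f,
      ← inner_sub_left]
    exact (abs_real_inner_le_norm _ _).trans (by gcongr)
  rw [← abs_nonpos_iff]
  refine ge_of_tendsto (x := 𝓝[>] (0 : ℝ)) (f := fun ε => ε * ‖W‖) ?_
    (eventually_mem_nhdsWithin.mono fun ε hε => key ε hε)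
  have : Tendsto (fun ε : ℝ => ε * ‖W‖) (𝓝 0) (𝓝 (0 * ‖W‖)) := tendsto_id.mul_const _
  rw [zero_mul] at this
  exact this.mono_left nhdsWithin_le_nhds

/-- The Haar measure need not be `σ`-finite, but each level set `{ε ≤ W}` has finite measure by
Chebyshev, hence is inner regular, and its compact subsets are null. -/
theorem ae_nonpos_of_pairing_eq_zero {W : Lp ℝ 2 μ} (hW : ∀ h, pairing W h = 0) :
    ∀ᵐ x ∂μ, W x ≤ 0 := by
  have hm : Measurable W := (Lp.stronglyMeasurable W).measurable
  have hlevel : ∀ ε : ℝ, 0 < ε → μ {x | ε ≤ W x} = 0 := fun ε hε => by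
    have hfin : μ {x | ε ≤ W x} < ∞ := by
      have := (Lp.memLp W).meas_ge_lt_top two_ne_zero (by simp)
        (ε := ε.toNNReal) (by simpa using hε)
      refine lt_of_le_of_lt (measure_mono fun x hx => ?_) this
      change ε.toNNReal ≤ ‖W x‖₊
      rw [← NNReal.coe_le_coe, Real.coe_toNNReal _ hε.le]
      exact le_trans hx (le_abs_self _)
    rw [(measurableSet_le measurable_const hm).measure_eq_iSup_isCompact_of_ne_top hfin.ne]
    simp only [ENNReal.iSup_eq_zero]
    intro t ht htc
    have h1 : ∫ _ in t, ε ∂μ ≤ ∫ x in t, W x ∂μ := by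
      refine setIntegral_mono_on ?_ ?_ htc.measurableSet fun x hx => ht hx
      · exact integrableOn_const htc.measure_ne_top
      · exact integrableOn_Lp_of_measure_ne_top W fact_one_le_two_ennreal.elim htc.measure_ne_top
    rw [setIntegral_eq_zero_of_pairing_eq_zero hW htc, setIntegral_const, smul_eq_mul] at h1
    have h2 : μ.real t = 0 := le_antisymm (by nlinarith) measureReal_nonneg
    exact (measureReal_eq_zero_iff htc.measure_ne_top).1 h2
  have hcover : {x | ¬ W x ≤ 0} ⊆ ⋃ n : ℕ, {x | 1 / ((n : ℝ) + 1) ≤ W x} := fun x hx => by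
    obtain ⟨n, hn⟩ := exists_nat_one_div_lt (not_le.1 hx)
    exact Set.mem_iUnion.2 ⟨n, hn.le⟩
  exact measure_mono_null hcover (measure_iUnion_null fun n => hlevel _ Nat.one_div_pos_of_nat)

theorem ae_eq_zero_of_pairing_eq_zero {W : Lp ℝ 2 μ} (hW : ∀ h, pairing W h = 0) :
    ∀ᵐ x ∂μ, W x = 0 := by
  have hW' : ∀ h, pairing (-W) h = 0 := fun h => by
    have := hW h
    rw [pairing_apply, coef] at this ⊢
    rw [smul_neg, inner_neg_right, this, neg_zero]
  filter_upwards [ae_nonpos_of_pairing_eq_zero hW, ae_nonpos_of_pairing_eq_zero hW',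
    Lp.coeFn_neg W] with x h1 h2 h3
  rw [h3, Pi.neg_apply] at h2
  linarith

/-- A continuous function and an `L²` function that agree as functionals on `C_c` agree almost
everywhere on compact sets. -/
theorem measure_inter_ne_eq_zero_of_isCompact {φ : G → ℝ} (hφ : Continuous φ) (Ψ : Lp ℝ 2 μ)
    (h : ∀ f : C_c(G, ℝ), ∫ x, f x * φ x ∂μ = ∫ x, f x * Ψ x ∂μ) {s : Set G} (hs : IsCompact s) :
    μ (s ∩ {x | φ x ≠ Ψ x}) = 0 := by
  obtain ⟨χ', hχ1, -, hχc, -⟩ := exists_continuous_one_zero_of_isCompact hs isClosed_empty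
    (Set.disjoint_empty s)
  let χ : C_c(G, ℝ) := ⟨χ', hχc⟩
  let w : C_c(G, ℝ) := ⟨⟨fun x => χ x * φ x, χ.continuous.mul hφ⟩, χ.hasCompactSupport.mul_right⟩
  have hm : MemLp (fun x => χ x * Ψ x) 2 μ :=
    (Lp.memLp Ψ).mul (p := ∞) (q := 2) (r := 2) (memLp_compactlySupported μ χ ∞)
  have hW : ∀ᵐ x ∂μ, (ccLp μ w - hm.toLp _) x = 0 := by
    refine ae_eq_zero_of_pairing_eq_zero fun f => ?_
    rw [pairing_eq_integral]
    have hfχ := h (f * χ)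
    have e1 : Integrable (fun x => (f * χ) x * φ x) μ := integrable_compactlySupported_mul μ _ hφ
    have e2 : Integrable (fun x => (f * χ) x * Ψ x) μ :=
      (memLp_compactlySupported μ (f * χ) 2).integrable_mul (Lp.memLp Ψ)
    rw [← sub_eq_zero, ← integral_sub e1 e2] at hfχ
    rw [← hfχ]
    refine integral_congr_ae ?_
    filter_upwards [Lp.coeFn_sub (ccLp μ w) (hm.toLp _), coeFn_ccLp μ w, hm.coeFn_toLp]
      with x h1 h2 h3
    rw [h1, Pi.sub_apply, h2, h3]
    simp [w]
    ring
  have hae : ∀ᵐ x ∂μ, χ x * φ x = χ x * Ψ x := by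
    filter_upwards [hW, Lp.coeFn_sub (ccLp μ w) (hm.toLp _), coeFn_ccLp μ w, hm.coeFn_toLp]
      with x h0 h1 h2 h3
    rw [h1, Pi.sub_apply, h2, h3] at h0
    exact sub_eq_zero.1 h0
  refine measure_mono_null ?_ (ae_iff.1 hae)
  rintro x ⟨hxs, hx⟩
  have : χ x = 1 := hχ1 hxs
  simpa [this] using hx

/-- Agreement on compact sets must be globalised without `σ`-finiteness. The disagreement set lies
where `φ` or `Ψ` is non-zero, a countable union of level sets. Those of `Ψ` are finite by Chebyshev.
Those of `φ` are open, so compact subsets compute their measure, and these lie in a level set of `Ψ`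
up to null sets. -/
theorem ae_eq_of_forall_integral_mul_eq {φ : G → ℝ} (hφ : Continuous φ) (Ψ : Lp ℝ 2 μ)
    (h : ∀ f : C_c(G, ℝ), ∫ x, f x * φ x ∂μ = ∫ x, f x * Ψ x ∂μ) : φ =ᵐ[μ] Ψ := by
  have hΨm : Measurable Ψ := (Lp.stronglyMeasurable Ψ).measurable
  have hΨfin : ∀ ε : ℝ, 0 < ε → μ {x | ε ≤ |Ψ x|} < ∞ := fun ε hε => by
    have := (Lp.memLp Ψ).meas_ge_lt_top two_ne_zero (by simp)
      (ε := ε.toNNReal) (by simpa using hε)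
    refine lt_of_le_of_lt (measure_mono fun x hx => ?_) this
    change ε.toNNReal ≤ ‖Ψ x‖₊
    rw [← NNReal.coe_le_coe, Real.coe_toNNReal _ hε.le]
    exact hx
  have hφfin : ∀ ε : ℝ, 0 < ε → μ {x | ε < |φ x|} < ∞ := fun ε hε => by
    refine lt_of_le_of_lt ?_ (hΨfin ε hε)
    have ho : IsOpen {x | ε < |φ x|} := isOpen_lt continuous_const hφ.abs
    rw [ho.measure_eq_iSup_isCompact]
    refine iSup₂_le fun s hs => iSup_le fun hsc => ?_
    have h0 := measure_inter_ne_eq_zero_of_isCompact hφ Ψ h hsc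
    refine (measure_mono (t := {x | ε ≤ |Ψ x|} ∪ s ∩ {x | φ x ≠ Ψ x}) fun x hx => ?_).trans
      ((measure_union_le _ _).trans (by rw [h0, add_zero]))
    by_cases hx' : φ x = Ψ x
    · have h1 : ε < |φ x| := hs hx
      rw [hx'] at h1
      exact Or.inl h1.le
    · exact Or.inr ⟨hx, hx'⟩
  have hD : MeasurableSet {x | φ x ≠ Ψ x} :=
    (measurableSet_eq_fun hφ.measurable hΨm).compl
  have hnull : ∀ s, MeasurableSet s → μ s < ∞ → μ (s ∩ {x | φ x ≠ Ψ x}) = 0 := by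
    intro s hs hsf
    rw [(hs.inter hD).measure_eq_iSup_isCompact_of_ne_top
      (ne_top_of_le_ne_top hsf.ne (measure_mono Set.inter_subset_left))]
    simp only [ENNReal.iSup_eq_zero]
    intro t ht htc
    exact measure_mono_null (Set.subset_inter subset_rfl fun x hx => (ht hx).2)
      (measure_inter_ne_eq_zero_of_isCompact hφ Ψ h htc)
  rw [EventuallyEq, ae_iff]
  have hcover : {x | ¬ φ x = Ψ x} ⊆ ⋃ n : ℕ,
      (({x | 1 / ((n : ℝ) + 1) < |φ x|} ∩ {x | φ x ≠ Ψ x}) ∪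
        ({x | 1 / ((n : ℝ) + 1) ≤ |Ψ x|} ∩ {x | φ x ≠ Ψ x})) := by
    intro x hx
    rw [Set.mem_iUnion]
    by_cases h0 : φ x = 0
    · have h1 : 0 < |Ψ x| := abs_pos.2 fun h2 => hx (h0.trans h2.symm)
      obtain ⟨n, hn⟩ := exists_nat_one_div_lt h1
      exact ⟨n, Or.inr ⟨hn.le, hx⟩⟩
    · obtain ⟨n, hn⟩ := exists_nat_one_div_lt (abs_pos.2 h0)
      exact ⟨n, Or.inl ⟨hn, hx⟩⟩
  refine measure_mono_null hcover (measure_iUnion_null fun n => measure_union_null ?_ ?_)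
  · exact hnull _ (isOpen_lt continuous_const hφ.abs).measurableSet
      (hφfin _ Nat.one_div_pos_of_nat)
  · exact hnull _ (measurableSet_le measurable_const hΨm.abs) (hΨfin _ Nat.one_div_pos_of_nat)

/-- An `L²` class whose form is symmetric and dominates its coefficients has a continuous positive
definite representative. -/
theorem exists_continuous_positiveDefinite_ae_eq (Ψ : Lp ℝ 2 μ)
    (hsymm : ∀ f h, form Ψ f h = form Ψ h f) (hdom : ∀ f y, coef Ψ f y ^ 2 ≤ form Ψ f f)
    (K : Subgroup G) (hK : ∀ f y, ∀ k ∈ K, coef Ψ f (y * k) = coef Ψ f y) :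
    ∃ φ : G → ℝ, Continuous φ ∧ IsPositiveDefinite (fun g => (φ g : ℂ)) ∧ IsBiInvariant K φ ∧
      φ 1 ≤ 1 ∧ φ =ᵐ[μ] Ψ := by
  let ε : ℕ → ℝ := fun j => 1 / ((j : ℝ) + 1)
  have hε : ∀ j, 0 < ε j := fun j => Nat.one_div_pos_of_nat
  have hε1 : ∀ j, ε j ≤ 1 := fun j => by
    rw [div_le_one (by positivity)]; linarith [(Nat.cast_nonneg j : (0 : ℝ) ≤ j)]
  have hεlim : Tendsto (fun j => Real.sqrt (4 * ε j)) atTop (𝓝 0) := by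
    have := ((tendsto_one_div_add_atTop_nhds_zero_nat (𝕜 := ℝ)).const_mul 4).sqrt
    rwa [mul_zero, Real.sqrt_zero] at this
  -- `F j` plays the role of an approximate delta function at the identity.
  have hex : ∀ j, ∃ f, ∀ h, (form Ψ f h - pairing Ψ h) ^ 2 ≤ ε j * form Ψ h h := fun j =>
    exists_approx_riesz (form Ψ) (pairing Ψ) hsymm (fun f => hdom f 1) (hε j)
  choose F hF using hex
  have hnn : ∀ f, 0 ≤ form Ψ f f := fun f => (sq_nonneg _).trans (hdom f 1)
  -- Comparing both Riesz estimates at `F i - F j` gives `D² ≤ 2 (ε i + ε j) D` for its form value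
  -- `D`; domination turns this into a bound uniform in `y`.
  have hdiff : ∀ i j, i ≤ j → ∀ y, |coef Ψ (F i) y - coef Ψ (F j) y| ≤ Real.sqrt (4 * ε i) := by
    intro i j hij y
    have hεij : ε j ≤ ε i := by
      simp only [ε]; gcongr
    have h1 := hF i (F i - F j)
    have h2 := hF j (F i - F j)
    have h3 := hdom (F i - F j) y
    have hc : coef Ψ (F i - F j) y = coef Ψ (F i) y - coef Ψ (F j) y := by
      rw [sub_eq_add_neg, ← neg_one_smul ℝ (F j), coef_add, coef_smul]; ring
    rw [hc] at h3
    have h4 : form Ψ (F i - F j) (F i - F j)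
        = form Ψ (F i) (F i - F j) - form Ψ (F j) (F i - F j) := by
      rw [map_sub (form Ψ), LinearMap.sub_apply]
    set D := form Ψ (F i - F j) (F i - F j)
    have hD0 : 0 ≤ D := hnn _
    have h5 : D ^ 2 ≤ 4 * ε i * D := by
      have : D ^ 2 ≤ 2 * (ε i * D) + 2 * (ε j * D) := by
        have h6 : D ^ 2 = (form Ψ (F i) (F i - F j) - form Ψ (F j) (F i - F j)) ^ 2 := by rw [← h4]
        rw [h6]
        nlinarith [sq_nonneg ((form Ψ (F i) (F i - F j) - pairing Ψ (F i - F j))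
          + (form Ψ (F j) (F i - F j) - pairing Ψ (F i - F j)))]
      nlinarith
    refine Real.abs_le_sqrt (h3.trans ?_)
    rcases hD0.eq_or_lt with h0 | h0
    · rw [← h0]; linarith [hε i]
    · rw [sq] at h5
      exact le_of_mul_le_mul_right h5 h0
  have hlim : ∀ y, ∃ a, Tendsto (fun j => coef Ψ (F j) y) atTop (𝓝 a) := fun y =>
    cauchySeq_tendsto_of_complete
      (cauchySeq_of_le_tendsto_0' _ (fun i j hij => hdiff i j hij y) hεlim)
  choose φ hφ using hlim
  have hunif : ∀ i y, |coef Ψ (F i) y - φ y| ≤ Real.sqrt (4 * ε i) := fun i y =>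
    le_of_tendsto ((hφ y).const_sub _).abs (eventually_atTop.2 ⟨i, fun j hij => hdiff i j hij y⟩)
  have hcont : Continuous φ := by
    have : TendstoUniformly (fun j => coef Ψ (F j)) φ atTop := by
      rw [Metric.tendstoUniformly_iff]
      intro δ hδ
      filter_upwards [hεlim.eventually (gt_mem_nhds hδ)] with j hj y
      rw [dist_comm]
      exact (hunif j y).trans_lt hj
    exact this.continuous (Frequently.of_forall fun j => continuous_coef Ψ (F j))
  -- For `q = form Ψ (F j) (F j)` and `p = pairing Ψ (F j)`, both `|q - p|` and `|p|` are at most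
  -- `√q`, so `q ≤ 2√q`.
  have hq : ∀ j, form Ψ (F j) (F j) ≤ 4 := fun j => by
    have h1 := hF j (F j)
    have h2 := hdom (F j) 1
    rw [← pairing_apply] at h2
    have h3 := hnn (F j)
    have h4 := mul_le_mul_of_nonneg_right (hε1 j) h3
    by_contra! hlt
    nlinarith [sq_nonneg (form Ψ (F j) (F j) - 2 * pairing Ψ (F j))]
  -- The Riesz estimate at the translate of `F j` exhibits `φ` as a limit of matrix coefficients of
  -- left translation; evenness, positive definiteness and `φ 1 ≤ 1` all follow from this.
  have hmat : ∀ x, Tendsto (fun j => form Ψ (F j) (leftTranslate x (F j))) atTop (𝓝 (φ x⁻¹)) := by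
    intro x
    have h1 : Tendsto (fun j => form Ψ (F j) (leftTranslate x (F j)) - coef Ψ (F j) x⁻¹) atTop
        (𝓝 0) := by
      refine squeeze_zero_norm (fun j => ?_) hεlim
      have h2 := hF j (leftTranslate x (F j))
      rw [form_leftTranslate, pairing_apply, coef_leftTranslate, mul_one] at h2
      refine Real.abs_le_sqrt (h2.trans ?_)
      rw [mul_comm]
      exact mul_le_mul_of_nonneg_right (hq j) (hε j).le
    simpa using h1.add (hφ x⁻¹)
  have hcomp : ∀ (x y : G) (f : C_c(G, ℝ)), leftTranslate x (leftTranslate y f) = leftTranslate (x * y) f :=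
    fun x y f => by ext z; simp [mul_assoc]
  have hone : ∀ f : C_c(G, ℝ), leftTranslate 1 f = f := fun f => by ext z; simp
  have heven : ∀ x, φ x⁻¹ = φ x := fun x => by
    refine tendsto_nhds_unique (hmat x) ?_
    have h1 := hmat x⁻¹
    rw [inv_inv] at h1
    refine h1.congr fun j => ?_
    rw [← form_leftTranslate Ψ x, hcomp, mul_inv_cancel, hone, hsymm]
  have hright : ∀ y, ∀ k ∈ K, φ (y * k) = φ y := fun y k hk =>
    tendsto_nhds_unique (hφ _) ((hφ y).congr fun j => (hK (F j) y k hk).symm)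
  refine ⟨φ, hcont, isPositiveDefinite_of_real heven fun n c g => ?_, fun k hk k' hk' g => ?_, ?_,
    ae_eq_of_forall_integral_mul_eq hcont Ψ fun h => ?_⟩
  · have h1 : Tendsto (fun l => ∑ i, ∑ j, c i * c j *
        form Ψ (F l) (leftTranslate ((g j)⁻¹ * g i) (F l))) atTop
        (𝓝 (∑ i, ∑ j, c i * c j * φ ((g i)⁻¹ * g j))) := by
      refine tendsto_finsetSum _ fun i _ => tendsto_finsetSum _ fun j _ => ?_
      have := (hmat ((g j)⁻¹ * g i)).const_mul (c i * c j)
      simpa using this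
    refine ge_of_tendsto' h1 fun l => (hnn (∑ i, c i • leftTranslate (g i) (F l))).trans_eq ?_
    simp only [map_sum, LinearMap.sum_apply, map_smul, LinearMap.smul_apply, smul_eq_mul]
    refine Finset.sum_congr rfl fun i _ => ?_
    rw [Finset.mul_sum]
    refine Finset.sum_congr rfl fun j _ => ?_
    rw [← form_leftTranslate Ψ (g j) (F l), hcomp, mul_inv_cancel_left]
    ring
  · rw [hright _ _ hk', ← heven, mul_inv_rev, hright _ _ (K.inv_mem hk), heven]
  · have h1 := hmat 1
    simp only [hone, inv_one] at h1
    have h2 : φ 1 ^ 2 ≤ φ 1 := le_of_tendsto_of_tendsto' ((hφ 1).pow 2) h1 fun j => hdom (F j) 1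
    nlinarith
  · rw [← pairing_eq_integral]
    -- The same sequence has two limits: `∫ h φ` by symmetry and uniform convergence of
    -- coefficients, and `∫ h Ψ` by the Riesz estimate.
    have h1 : Tendsto (fun j => form Ψ (F j) h) atTop (𝓝 (∫ x, h x * φ x ∂μ)) := by
      rw [tendsto_iff_norm_sub_tendsto_zero]
      have h0 := hεlim.const_mul (∫ y, |h y| ∂μ)
      rw [mul_zero] at h0
      refine squeeze_zero (fun _ => norm_nonneg _) (fun j => ?_) h0
      rw [hsymm, form_apply,
        ← integral_sub (integrable_compactlySupported_mul μ h (continuous_coef _ _))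
          (integrable_compactlySupported_mul μ h hcont), ← integral_mul_const]
      refine norm_integral_le_of_norm_le
        ((memLp_one_iff_integrable.1 (memLp_compactlySupported μ h 1)).abs.mul_const _)
        (ae_of_all _ fun y => ?_)
      rw [← mul_sub, Real.norm_eq_abs, abs_mul]
      exact mul_le_mul_of_nonneg_left (hunif j y) (abs_nonneg _)
    have h2 : Tendsto (fun j => form Ψ (F j) h) atTop (𝓝 (pairing Ψ h)) := by
      have h3 : Tendsto (fun j => form Ψ (F j) h - pairing Ψ h) atTop (𝓝 0) := by
        have h4 : Tendsto (fun j => Real.sqrt (ε j * form Ψ h h)) atTop (𝓝 0) := by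
          have :=
            ((tendsto_one_div_add_atTop_nhds_zero_nat (𝕜 := ℝ)).mul_const (form Ψ h h)).sqrt
          rwa [zero_mul, Real.sqrt_zero] at this
        exact squeeze_zero_norm (fun j => Real.abs_le_sqrt (hF j h)) h4
      simpa using h3.add_const (pairing Ψ h)
    exact tendsto_nhds_unique h1 h2

end Representative

/-! ### Bounds, convexity and sign conditions of the class. -/

theorem IsPositiveDefinite.abs_apply_le {G : Type u} [Group G] {φ : G → ℝ}
    (h : IsPositiveDefinite (fun g => (φ g : ℂ))) (x : G) : |φ x| ≤ φ 1 := by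
  obtain ⟨H, _, _, _, v, hv⟩ := h.exists_featureMap
  have hn : ∀ y, ‖v y‖ * ‖v y‖ = φ 1 := fun y => by
    rw [← real_inner_self_eq_norm_mul_norm, hv, inv_mul_cancel]
  have hn1 : ‖v x‖ = ‖v 1‖ :=
    (mul_self_inj (norm_nonneg _) (norm_nonneg _)).1 ((hn x).trans (hn 1).symm)
  have h1 := abs_real_inner_le_norm (v 1) (v x)
  rwa [hv, inv_one, one_mul, hn1, hn] at h1

theorem IsPositiveDefinite.linear_comb {G : Type*} [Group G] {φ ψ : G → ℝ}
    (hφ : IsPositiveDefinite (fun g => (φ g : ℂ))) (hψ : IsPositiveDefinite (fun g => (ψ g : ℂ)))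
    {a b : ℝ} (ha : 0 ≤ a) (hb : 0 ≤ b) :
    IsPositiveDefinite (fun g => ((a * φ g + b * ψ g : ℝ) : ℂ)) := by
  refine isPositiveDefinite_of_real (φ := fun g => a * φ g + b * ψ g)
    (fun x => by rw [hφ.apply_inv, hψ.apply_inv]) fun n c g => ?_
  refine (add_nonneg (mul_nonneg ha (hφ.real_sum_nonneg n c g))
    (mul_nonneg hb (hψ.real_sum_nonneg n c g))).trans_eq ?_
  simp only [Finset.mul_sum, ← Finset.sum_add_distrib]
  refine Finset.sum_congr rfl fun i _ => Finset.sum_congr rfl fun j _ => ?_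
  ring

theorem tsupport_max_zero_subset_iff {G : Type*} [TopologicalSpace G] {φ : G → ℝ} {U : Set G}
    (hU : IsClosed U) : tsupport (fun g => max (φ g) 0) ⊆ U ↔ ∀ x ∉ U, φ x ≤ 0 := by
  constructor
  · intro h x hx
    have := image_eq_zero_of_notMem_tsupport (f := fun g => max (φ g) 0) fun hx' => hx (h hx')
    simpa using this
  · intro h
    refine closure_minimal (fun x hx => ?_) hU
    by_contra hxU
    exact hx (max_eq_right (h x hxU))

/-- Closedness of `U` and `V` turns the support conditions into pointwise inequalities, which pass
easily to convex combinations and limits. -/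
theorem mem_delsarteClass_iff {G : Type*} [Group G] [TopologicalSpace G] {K : Subgroup G}
    {U V : Set G} (hU : IsClosed U) (hV : IsClosed V) {φ : G → ℝ} :
    φ ∈ delsarteClass K U V ↔ Continuous φ ∧ IsPositiveDefinite (fun g => (φ g : ℂ)) ∧
      IsBiInvariant K φ ∧ φ 1 = 1 ∧ (∀ x ∉ U, φ x ≤ 0) ∧ ∀ x ∉ V, 0 ≤ φ x := by
  rw [← tsupport_max_zero_subset_iff hU]
  simp only [delsarteClass, ← neg_nonpos (a := φ _)]
  rw [← tsupport_max_zero_subset_iff (φ := fun x => -φ x) hV]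
  rfl

theorem delsarteClass_linear_comb {G : Type*} [Group G] [TopologicalSpace G] {K : Subgroup G}
    {U V : Set G} (hU : IsClosed U) (hV : IsClosed V) {φ ψ : G → ℝ}
    (hφ : φ ∈ delsarteClass K U V) (hψ : ψ ∈ delsarteClass K U V) {a b : ℝ}
    (ha : 0 ≤ a) (hb : 0 ≤ b) (hab : a + b = 1) :
    (fun g => a * φ g + b * ψ g) ∈ delsarteClass K U V := by
  rw [mem_delsarteClass_iff hU hV] at hφ hψ ⊢
  obtain ⟨c1, p1, i1, e1, u1, v1⟩ := hφ
  obtain ⟨c2, p2, i2, e2, u2, v2⟩ := hψ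
  refine ⟨by fun_prop, p1.linear_comb p2 ha hb, fun k hk k' hk' g => ?_, ?_, fun x hx => ?_,
    fun x hx => ?_⟩
  · simp only [i1 k hk k' hk' g, i2 k hk k' hk' g]
  · simp only [e1, e2, mul_one, hab]
  · nlinarith [u1 x hx, u2 x hx]
  · have := v1 x hx
    have := v2 x hx
    positivity

/-! ### A member of the class with positive integral. -/

section Witness

variable {G : Type u} [Group G] [TopologicalSpace G] [IsTopologicalGroup G]
  [LocallyCompactSpace G] [T2Space G] [MeasurableSpace G] [BorelSpace G]
  {μ : Measure G} [μ.IsHaarMeasure] [μ.Regular]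

/-- The normalised autocorrelation `g ↦ μ (W ∩ gW) / μ W` of a compact set `W = KN` is an element
of the class with positive integral. -/
theorem exists_mem_delsarteClass_integral_pos {K : Subgroup G} (hK : IsCompact (K : Set G))
    {U V : Set G} (hU : IsClosed U) (hUinv : IsBiInvariantSet K U) (hU1 : U ∈ 𝓝 (1 : G))
    (hV : IsClosed V) :
    ∃ ψ ∈ delsarteClass K U V, Integrable ψ μ ∧ 0 < ∫ g, ψ g ∂μ := by
  -- Quotients of elements of `N'` lie in `U`, hence `W W⁻¹ ⊆ K U K ⊆ U` for `W = KN`.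
  obtain ⟨N', hN', hNU⟩ := exists_nhds_split_inv hU1
  obtain ⟨N, hN1, hNN', hNc⟩ := local_compact_nhds hN'
  set W : Set G := (K : Set G) * N with hWdef
  have hWc : IsCompact W := hK.mul hNc
  have hWm : MeasurableSet W := hWc.measurableSet
  have hWf : μ W ≠ ∞ := hWc.measure_ne_top
  have hW1 : W ∈ 𝓝 (1 : G) :=
    mem_of_superset hN1 fun x hx => ⟨1, K.one_mem, x, hx, one_mul x⟩
  have hq : 0 < μ.real W :=
    ENNReal.toReal_pos (Measure.measure_pos_of_mem_nhds μ hW1).ne' hWf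
  have hWK : ∀ k ∈ K, (fun x => k • x) ⁻¹' W = W := by
    have hsub : ∀ k ∈ K, ∀ x ∈ W, k * x ∈ W := by
      rintro k hk _ ⟨k', hk', x, hx, rfl⟩
      exact ⟨k * k', K.mul_mem hk hk', x, hx, mul_assoc _ _ _⟩
    intro k hk
    ext x
    refine ⟨fun hx => ?_, fun hx => hsub k hk x hx⟩
    simpa using hsub k⁻¹ (K.inv_mem hk) _ hx
  set a : Lp ℝ 2 μ := indicatorConstLp 2 hWm hWf (1 : ℝ) with ha
  have haK : ∀ k ∈ K, DomMulAct.mk k • a = a := fun k hk => by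
    rw [ha, DomMulAct.mk_smul_indicatorConstLp]
    simp only [hWK k hk]
  have hval : ∀ g : G, inner ℝ a (DomMulAct.mk g⁻¹ • a)
      = μ.real (W ∩ (fun x => g⁻¹ • x) ⁻¹' W) := fun g => by
    rw [ha, DomMulAct.mk_smul_indicatorConstLp]
    exact L2.real_inner_indicatorConstLp_one_indicatorConstLp_one hWm _ hWf
      (by rwa [SMulInvariantMeasure.measure_preimage_smul _ hWm])
  -- As a matrix coefficient of translation on `L²`, `ψ` is continuous and positive definite; it is
  -- `K`-bi-invariant because `a` is fixed by `K`.
  let ψ : G → ℝ := fun g => inner ℝ a (DomMulAct.mk g⁻¹ • a) / μ.real W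
  have hψcont : Continuous ψ := by
    have : Fact ((2 : ℝ≥0∞) ≠ ∞) := ⟨by simp⟩
    have h1 : Continuous fun y : G => DomMulAct.mk y⁻¹ • a :=
      (DomMulAct.continuous_mk.comp continuous_inv).smul continuous_const
    exact (continuous_const.inner h1).div_const _
  have hψ0 : ∀ g, 0 ≤ ψ g := fun g => by
    simp only [ψ, hval]; positivity
  have hψ1 : ψ 1 = 1 := by
    simp only [ψ, hval]
    simp [hq.ne']
  have hsupp : ∀ g, ψ g ≠ 0 → ∃ x ∈ W, ∃ y ∈ W, g = x * y⁻¹ := fun g hg => by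
    have : (W ∩ (fun x => g⁻¹ • x) ⁻¹' W).Nonempty := by
      by_contra hne
      rw [Set.not_nonempty_iff_eq_empty] at hne
      exact hg (by simp only [ψ, hval, hne]; simp)
    obtain ⟨x, hx, hx'⟩ := this
    exact ⟨x, hx, g⁻¹ * x, hx', by group⟩
  have hpd : IsPositiveDefinite (fun g => (ψ g : ℂ)) := by
    have hval2 : ∀ x y : G, inner ℝ a (DomMulAct.mk (x⁻¹ * y)⁻¹ • a)
        = inner ℝ (DomMulAct.mk x⁻¹ • a) (DomMulAct.mk y⁻¹ • a) := fun x y => by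
      rw [← inner_domMulAct_smul μ (DomMulAct.mk x⁻¹) a, smul_smul, ← DomMulAct.mk_mul]
      simp
    refine isPositiveDefinite_of_real (fun x => ?_) fun n c g => ?_
    · simp only [ψ]
      have h1 := hval2 x 1
      have h2 := hval2 1 x
      rw [mul_one] at h1
      rw [inv_one, one_mul] at h2
      rw [h1, h2, inv_one, real_inner_comm]
    · have h1 : 0 ≤ inner ℝ (∑ i, c i • DomMulAct.mk (g i)⁻¹ • a)
          (∑ i, c i • DomMulAct.mk (g i)⁻¹ • a) / μ.real W :=
        div_nonneg real_inner_self_nonneg hq.le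
      refine h1.trans_eq ?_
      rw [sum_inner, Finset.sum_div]
      refine Finset.sum_congr rfl fun i _ => ?_
      rw [inner_sum, Finset.sum_div]
      refine Finset.sum_congr rfl fun j _ => ?_
      simp only [ψ, hval2, inner_smul_left, inner_smul_right]
      simp
      ring
  have hinv : IsBiInvariant K ψ := fun k hk k' hk' g => by
    simp only [ψ]
    rw [mul_inv_rev, mul_inv_rev, DomMulAct.mk_mul, DomMulAct.mk_mul, mul_smul, mul_smul,
      haK _ (K.inv_mem hk')]
    nth_rw 1 [← haK _ (K.inv_mem hk)]
    rw [inner_domMulAct_smul]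
  have hψU : ∀ x ∉ U, ψ x ≤ 0 := fun g hgU => by
    by_contra hg
    obtain ⟨x, ⟨k, hk, n, hn, rfl⟩, y, ⟨k', hk', n', hn', rfl⟩, rfl⟩ :=
      hsupp g (fun h0 => hg h0.le)
    refine hgU ?_
    have h1 : n / n' ∈ U := hNU n (hNN' hn) n' (hNN' hn')
    have h2 := (hUinv k hk k'⁻¹ (K.inv_mem hk') (n / n')).2 h1
    simpa [div_eq_mul_inv, mul_assoc] using h2
  have hψc : HasCompactSupport ψ := by
    refine HasCompactSupport.intro (hWc.mul hWc.inv) fun g hg => ?_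
    by_contra h0
    obtain ⟨x, hx, y, hy, rfl⟩ := hsupp g h0
    exact hg ⟨x, hx, y⁻¹, Set.inv_mem_inv.2 hy, rfl⟩
  refine ⟨ψ, (mem_delsarteClass_iff hU hV).2
    ⟨hψcont, hpd, hinv, hψ1, hψU, fun x _ => hψ0 x⟩,
    hψcont.integrable_of_hasCompactSupport hψc, ?_⟩
  exact hψcont.integral_pos_of_hasCompactSupport_nonneg_nonzero hψc hψ0
    (x := 1) (by rw [hψ1]; exact one_ne_zero)

end Witness

/-! ### Integral estimates and the Fatou argument. -/

theorem extIntegral_eq_integral {G : Type*} [MeasurableSpace G] {μ : Measure G} {φ : G → ℝ}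
    (hφ : Integrable φ μ) : extIntegral μ φ = ((∫ g, φ g ∂μ : ℝ) : EReal) := by
  have h1 : ∫⁻ g, ENNReal.ofReal (φ g) ∂μ ≠ ∞ :=
    ne_top_of_le_ne_top hφ.2.ne (lintegral_mono fun x => Real.ofReal_le_enorm _)
  have h2 : ∫⁻ g, ENNReal.ofReal (-φ g) ∂μ ≠ ∞ :=
    ne_top_of_le_ne_top hφ.neg.2.ne (lintegral_mono fun x => Real.ofReal_le_enorm _)
  rw [extIntegral, integral_eq_lintegral_pos_part_sub_lintegral_neg_part hφ, EReal.coe_sub,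
    EReal.coe_ennreal_toReal h1, EReal.coe_ennreal_toReal h2]

section Extremal

set_option linter.unusedSectionVars false

variable {G : Type u} [Group G] [TopologicalSpace G] [MeasurableSpace G] [BorelSpace G]
  {μ : Measure G} {K : Subgroup G} {U V : Set G}

theorem delsarteClass_le_indicator (hU : IsClosed U) (hV : IsClosed V) {φ : G → ℝ}
    (hφ : φ ∈ delsarteClass K U V) (x : G) : φ x ≤ U.indicator (fun _ => (1 : ℝ)) x := by
  obtain ⟨-, hpd, -, h1, hφU, -⟩ := (mem_delsarteClass_iff hU hV).1 hφ
  by_cases hx : x ∈ U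
  · rw [Set.indicator_of_mem hx]
    exact (le_abs_self _).trans ((hpd.abs_apply_le x).trans h1.le)
  · rw [Set.indicator_of_notMem hx]
    exact hφU x hx

theorem integrable_indicator_one (hU : IsClosed U) (hUf : μ U < ∞) :
    Integrable (U.indicator fun _ => (1 : ℝ)) μ :=
  (integrable_indicator_iff hU.measurableSet).2 (integrableOn_const hUf.ne)

theorem integral_indicator_one_eq (hU : IsClosed U) :
    ∫ x, U.indicator (fun _ => (1 : ℝ)) x ∂μ = μ.real U := by
  rw [integral_indicator hU.measurableSet]
  simp

theorem integral_le_of_mem_delsarteClass (hU : IsClosed U) (hV : IsClosed V) (hUf : μ U < ∞)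
    {φ : G → ℝ} (hφ : φ ∈ delsarteClass K U V) (hint : Integrable φ μ) :
    ∫ x, φ x ∂μ ≤ μ.real U := by
  rw [← integral_indicator_one_eq hU]
  exact integral_mono hint (integrable_indicator_one hU hUf) (delsarteClass_le_indicator hU hV hφ)

theorem integrable_sq_of_mem_delsarteClass (hU : IsClosed U) (hV : IsClosed V)
    {φ : G → ℝ} (hφ : φ ∈ delsarteClass K U V) (hint : Integrable φ μ) :
    Integrable (fun x => φ x ^ 2) μ ∧ ∀ x, φ x ^ 2 ≤ |φ x| := by
  obtain ⟨hc, hpd, -, h1, -, -⟩ := (mem_delsarteClass_iff hU hV).1 hφ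
  have hle : ∀ x, φ x ^ 2 ≤ |φ x| := fun x => by
    have := hpd.abs_apply_le x
    rw [h1] at this
    rw [← sq_abs]
    nlinarith [abs_nonneg (φ x)]
  refine ⟨hint.abs.mono' (hint.1.pow 2) (ae_of_all _ fun x => ?_), hle⟩
  rw [Real.norm_eq_abs, abs_of_nonneg (sq_nonneg _)]
  exact hle x

/-- A lower bound on the integral becomes an `L²` bound, through `φ² ≤ |φ| = 2φ₊ - φ ≤ 2·1_U - φ`.
-/
theorem integral_sq_le_of_mem_delsarteClass (hU : IsClosed U) (hV : IsClosed V) (hUf : μ U < ∞)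
    {φ : G → ℝ} (hφ : φ ∈ delsarteClass K U V) (hint : Integrable φ μ) :
    ∫ x, φ x ^ 2 ∂μ ≤ 2 * μ.real U - ∫ x, φ x ∂μ := by
  obtain ⟨hsq, hle⟩ := integrable_sq_of_mem_delsarteClass hU hV hφ hint
  have hind := integrable_indicator_one (μ := μ) hU hUf
  rw [← integral_indicator_one_eq hU, ← integral_const_mul, ← integral_sub (hind.const_mul 2) hint]
  refine integral_mono hsq ((hind.const_mul 2).sub hint) fun x => (hle x).trans ?_
  have h1 := delsarteClass_le_indicator hU hV hφ x
  have h2 : 0 ≤ U.indicator (fun _ => (1 : ℝ)) x := Set.indicator_nonneg (fun _ _ => zero_le_one) x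
  rcases abs_cases (φ x) with h | h <;> linarith

theorem memLp_two_of_mem_delsarteClass (hU : IsClosed U) (hV : IsClosed V)
    {φ : G → ℝ} (hφ : φ ∈ delsarteClass K U V) (hint : Integrable φ μ) : MemLp φ 2 μ :=
  (memLp_two_iff_integrable_sq hint.1).2 (integrable_sq_of_mem_delsarteClass hU hV hφ hint).1

/-- The positive part is always integrable, so a non-integrable member has negative part of infinite
integral and extended integral `⊥`. -/
theorem extIntegral_le_of_forall_integrable (hU : IsClosed U) (hV : IsClosed V) (hUf : μ U < ∞)
    {c : ℝ} (h : ∀ φ ∈ delsarteClass K U V, Integrable φ μ → ∫ x, φ x ∂μ ≤ c)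
    {φ : G → ℝ} (hφ : φ ∈ delsarteClass K U V) : extIntegral μ φ ≤ (c : EReal) := by
  by_cases hint : Integrable φ μ
  · rw [extIntegral_eq_integral hint]
    exact_mod_cast h φ hφ hint
  · have hcont : Continuous φ := hφ.1
    have hind := integrable_indicator_one (μ := μ) hU hUf
    have hpos : ∫⁻ g, ENNReal.ofReal (φ g) ∂μ ≠ ∞ :=
      ne_top_of_le_ne_top hind.2.ne (lintegral_mono fun x =>
        (ENNReal.ofReal_le_ofReal (delsarteClass_le_indicator hU hV hφ x)).trans
          (Real.ofReal_le_enorm _))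
    have hneg : ∫⁻ g, ENNReal.ofReal (-φ g) ∂μ = ∞ := by
      by_contra hne
      refine hint ⟨hcont.measurable.aestronglyMeasurable, ?_⟩
      have hle : ∫⁻ g, ‖φ g‖ₑ ∂μ
          ≤ ∫⁻ g, (ENNReal.ofReal (φ g) + ENNReal.ofReal (-φ g)) ∂μ := by
        refine lintegral_mono fun g => ?_
        rw [Real.enorm_eq_ofReal_abs]
        rcases abs_choice (φ g) with h | h <;> rw [h]
        · exact le_self_add
        · exact le_add_self
      rw [lintegral_add_left (by fun_prop)] at hle
      exact hle.trans_lt (ENNReal.add_lt_top.2 ⟨hpos.lt_top, lt_top_iff_ne_top.2 hne⟩)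
    rw [extIntegral, hneg, ← EReal.coe_ennreal_toReal hpos]
    simp

/-- Fatou's lemma for functions bounded above by an indicator of finite integral. -/
theorem integrable_and_le_integral_of_tendsto (hU : IsClosed U) (hUf : μ U < ∞)
    {φ : ℕ → G → ℝ} {ψ : G → ℝ} {c : ℕ → ℝ} {C : ℝ}
    (hle : ∀ n x, φ n x ≤ U.indicator (fun _ => (1 : ℝ)) x) (hcont : ∀ n, Continuous (φ n))
    (hint : ∀ n, Integrable (φ n) μ) (hψ : Continuous ψ)
    (hlim : ∀ᵐ x ∂μ, Tendsto (fun n => φ n x) atTop (𝓝 (ψ x)))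
    (hc : ∀ n, c n ≤ ∫ x, φ n x ∂μ) (hC : Tendsto c atTop (𝓝 C)) :
    Integrable ψ μ ∧ C ≤ ∫ x, ψ x ∂μ := by
  set I : G → ℝ := U.indicator fun _ => (1 : ℝ) with hI
  have hImeas : Measurable I := measurable_const.indicator hU.measurableSet
  have hIint : Integrable I μ := integrable_indicator_one hU hUf
  have hIψ : ∀ᵐ x ∂μ, 0 ≤ I x - ψ x := by
    filter_upwards [hlim] with x hx
    exact sub_nonneg.2 (le_of_tendsto' hx fun n => hle n x)
  have hlin : ∀ n, ∫⁻ x, ENNReal.ofReal (I x - φ n x) ∂μ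
      = ENNReal.ofReal (μ.real U - ∫ x, φ n x ∂μ) := fun n => by
    have hsub : Integrable (fun x => I x - φ n x) μ := hIint.sub (hint n)
    rw [← ofReal_integral_eq_lintegral_ofReal hsub
      (ae_of_all _ fun x => sub_nonneg.2 (hle n x)), integral_sub hIint (hint n),
      integral_indicator_one_eq hU]
  have hfatou : ∫⁻ x, ENNReal.ofReal (I x - ψ x) ∂μ ≤ ENNReal.ofReal (μ.real U - C) := by
    calc ∫⁻ x, ENNReal.ofReal (I x - ψ x) ∂μ
        = ∫⁻ x, liminf (fun n => ENNReal.ofReal (I x - φ n x)) atTop ∂μ := by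
          refine lintegral_congr_ae ?_
          filter_upwards [hlim] with x hx
          exact ((ENNReal.continuous_ofReal.tendsto _).comp (hx.const_sub (I x))).liminf_eq.symm
      _ ≤ liminf (fun n => ∫⁻ x, ENNReal.ofReal (I x - φ n x) ∂μ) atTop :=
          lintegral_liminf_le fun n =>
            (hImeas.sub (hcont n).measurable).ennreal_ofReal
      _ ≤ liminf (fun n => ENNReal.ofReal (μ.real U - c n)) atTop := by
          refine liminf_le_liminf (Eventually.of_forall fun n => ?_)
          simp only [hlin]
          exact ENNReal.ofReal_le_ofReal (by linarith [hc n])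
      _ = ENNReal.ofReal (μ.real U - C) :=
          ((ENNReal.continuous_ofReal.tendsto _).comp (hC.const_sub _)).liminf_eq
  have hdiff : Integrable (fun x => I x - ψ x) μ := by
    refine (lintegral_ofReal_ne_top_iff_integrable
      (hImeas.sub hψ.measurable).aestronglyMeasurable hIψ).1 ?_
    exact ne_top_of_le_ne_top ENNReal.ofReal_ne_top hfatou
  have hψint : Integrable ψ μ := by
    have := hIint.sub hdiff
    refine this.congr (ae_of_all _ fun x => ?_)
    simp
  refine ⟨hψint, ?_⟩
  rw [← ofReal_integral_eq_lintegral_ofReal hdiff hIψ, integral_sub hIint hψint,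
    integral_indicator_one_eq hU] at hfatou
  -- `ENNReal.ofReal` truncates at zero, so real values can be compared only once the right-hand
  -- side is known to be non-negative.
  have hCU : C ≤ μ.real U := by
    refine le_of_tendsto' hC fun n => (hc n).trans ?_
    rw [← integral_indicator_one_eq hU]
    exact integral_mono (hint n) hIint (hle n)
  have := (ENNReal.ofReal_le_ofReal_iff (sub_nonneg.2 hCU)).1 hfatou
  linarith

end Extremal

/-! ### Passage to the limit and the maximiser. -/

section Limit

variable {G : Type u} [Group G] [TopologicalSpace G] [IsTopologicalGroup G]
  [LocallyCompactSpace G] [T2Space G] [MeasurableSpace G] [BorelSpace G]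
  {μ : Measure G} [μ.IsHaarMeasure] [μ.Regular] {K : Subgroup G} {U V : Set G}

/-- An `L²` limit of integrable elements of the class has a continuous positive definite
representative satisfying the same sign conditions. -/
theorem exists_limit_of_tendsto_Lp (hU : IsClosed U) (hV : IsClosed V)
    {φ : ℕ → G → ℝ} (hφ : ∀ n, φ n ∈ delsarteClass K U V) {P : ℕ → Lp ℝ 2 μ} {Ψ : Lp ℝ 2 μ}
    (hP : ∀ n, P n =ᵐ[μ] φ n) (hlim : Tendsto P atTop (𝓝 Ψ)) :
    ∃ ψ : G → ℝ, Continuous ψ ∧ IsPositiveDefinite (fun g => (ψ g : ℂ)) ∧ IsBiInvariant K ψ ∧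
      ψ 1 ≤ 1 ∧ (∀ x ∉ U, ψ x ≤ 0) ∧ (∀ x ∉ V, 0 ≤ ψ x) ∧
      ∃ ns : ℕ → ℕ, StrictMono ns ∧
        ∀ᵐ x ∂μ, Tendsto (fun i => φ (ns i) x) atTop (𝓝 (ψ x)) := by
  have hcls := fun n => (mem_delsarteClass_iff hU hV).1 (hφ n)
  have hmem : ∀ n, MemLp (φ n) 2 μ := fun n => (memLp_congr_ae (hP n)).1 (Lp.memLp (P n))
  have hPeq : ∀ n, P n = (hmem n).toLp (φ n) := fun n =>
    Lp.ext ((hP n).trans (hmem n).coeFn_toLp.symm)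
  have hprops := fun n => (hcls n).2.1.form_props (hcls n).1 (hcls n).2.2.2.1 (hmem n)
  simp only [← hPeq] at hprops
  obtain ⟨ψ, hψc, hψpd, hψK, hψ1, hψae⟩ := exists_continuous_positiveDefinite_ae_eq Ψ
    (fun f h => tendsto_nhds_unique (tendsto_form hlim f h)
      ((tendsto_form hlim h f).congr fun n => (hprops n).1 h f))
    (fun f y => le_of_tendsto_of_tendsto' ((tendsto_coef hlim f y).pow 2) (tendsto_form hlim f f)
      fun n => (hprops n).2 f y) K
    -- The coefficient at `y k` integrates `φ n (k⁻¹ y⁻¹ z)`, so left invariance of `φ n` gives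
    -- right invariance of the coefficient.
    (fun f y k hk => tendsto_nhds_unique (tendsto_coef hlim f (y * k))
      ((tendsto_coef hlim f y).congr fun n => by
        rw [hPeq, coef_toLp, coef_toLp]
        refine integral_congr_ae (ae_of_all _ fun z => ?_)
        have := (hcls n).2.2.1 k⁻¹ (K.inv_mem hk) 1 K.one_mem (y⁻¹ * z)
        simp only [mul_one] at this
        simp only [mul_inv_rev, mul_assoc, this]))
  obtain ⟨ns, hns, hae⟩ := (tendstoInMeasure_of_tendsto_Lp hlim).exists_seq_tendsto_ae
  have hae' : ∀ᵐ x ∂μ, Tendsto (fun i => φ (ns i) x) atTop (𝓝 (ψ x)) := by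
    filter_upwards [hae, hψae, ae_all_iff.2 hP] with x h1 h2 h3
    rw [h2]
    exact h1.congr fun i => h3 (ns i)
  refine ⟨ψ, hψc, hψpd, hψK, hψ1, ?_, ?_, ns, hns, hae'⟩
  -- The a.e. sign condition holds everywhere because an open null set for Haar measure is empty.
  · have hopen : IsOpen (Uᶜ ∩ {x | 0 < ψ x}) :=
      hU.isOpen_compl.inter (isOpen_lt continuous_const hψc)
    have hnull : μ (Uᶜ ∩ {x | 0 < ψ x}) = 0 := by
      refine measure_mono_null ?_ (ae_iff.1 hae')
      rintro x ⟨hxU, hx⟩ hx'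
      exact absurd (le_of_tendsto' hx' fun i => (hcls (ns i)).2.2.2.2.1 x hxU) (not_le.2 hx)
    have hempty := (hopen.measure_eq_zero_iff μ).1 hnull
    intro x hx
    by_contra! hlt
    exact (hempty ▸ (⟨hx, hlt⟩ : x ∈ Uᶜ ∩ {x | 0 < ψ x}) : x ∈ (∅ : Set G))
  · have hopen : IsOpen (Vᶜ ∩ {x | ψ x < 0}) :=
      hV.isOpen_compl.inter (isOpen_lt hψc continuous_const)
    have hnull : μ (Vᶜ ∩ {x | ψ x < 0}) = 0 := by
      refine measure_mono_null ?_ (ae_iff.1 hae')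
      rintro x ⟨hxV, hx⟩ hx'
      exact absurd (ge_of_tendsto' hx' fun i => (hcls (ns i)).2.2.2.2.2 x hxV) (not_le.2 hx)
    have hempty := (hopen.measure_eq_zero_iff μ).1 hnull
    intro x hx
    by_contra! hlt
    exact (hempty ▸ (⟨hx, hlt⟩ : x ∈ Vᶜ ∩ {x | ψ x < 0}) : x ∈ (∅ : Set G))

/-- Some integrable element of the class maximises the integral among integrable elements. -/
theorem exists_integrable_maximizer (hK : IsCompact (K : Set G)) (hU : IsClosed U)
    (hUinv : IsBiInvariantSet K U) (hU1 : U ∈ 𝓝 (1 : G)) (hUf : μ U < ∞) (hV : IsClosed V) :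
    ∃ φ ∈ delsarteClass K U V, Integrable φ μ ∧
      ∀ ψ ∈ delsarteClass K U V, Integrable ψ μ → ∫ x, ψ x ∂μ ≤ ∫ x, φ x ∂μ := by
  obtain ⟨ψ₀, hψ₀, hψ₀int, hψ₀pos⟩ :=
    exists_mem_delsarteClass_integral_pos (μ := μ) hK hU hUinv hU1 hV
  let T : Set ℝ := {r | ∃ φ ∈ delsarteClass K U V, Integrable φ μ ∧ ∫ x, φ x ∂μ = r}
  have hTne : T.Nonempty := ⟨_, ψ₀, hψ₀, hψ₀int, rfl⟩
  have hTbdd : BddAbove T := by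
    refine ⟨μ.real U, ?_⟩
    rintro _ ⟨φ, hφ, hint, rfl⟩
    exact integral_le_of_mem_delsarteClass hU hV hUf hφ hint
  set C := sSup T
  have hle_C : ∀ φ ∈ delsarteClass K U V, Integrable φ μ → ∫ x, φ x ∂μ ≤ C :=
    fun φ hφ hint => le_csSup hTbdd ⟨φ, hφ, hint, rfl⟩
  have hCpos : 0 < C := hψ₀pos.trans_le (hle_C _ hψ₀ hψ₀int)
  -- The `L²` classes of members within `1 / (n + 1)` of the supremum.
  let A : ℕ → Set (Lp ℝ 2 μ) := fun n => {x | ∃ φ ∈ delsarteClass K U V, Integrable φ μ ∧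
    C - 1 / ((n : ℝ) + 1) ≤ ∫ x, φ x ∂μ ∧ x =ᵐ[μ] φ}
  have hA : Antitone A := by
    rintro m n hmn x ⟨φ, hφ, hint, hge, hx⟩
    refine ⟨φ, hφ, hint, le_trans ?_ hge, hx⟩
    gcongr
  have hAne : ∀ n, (A n).Nonempty := fun n => by
    obtain ⟨_, ⟨φ, hφ, hint, rfl⟩, hlt⟩ := exists_lt_of_lt_csSup hTne
      (sub_lt_self C (Nat.one_div_pos_of_nat (α := ℝ) (n := n)))
    have hm := memLp_two_of_mem_delsarteClass hU hV hφ hint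
    exact ⟨hm.toLp φ, φ, hφ, hint, hlt.le, hm.coeFn_toLp⟩
  have hAconv : ∀ n, Convex ℝ (A n) := by
    rintro n x ⟨φ, hφ, hφint, hφge, hx⟩ y ⟨ψ, hψ, hψint, hψge, hy⟩ a b ha hb hab
    refine ⟨_, delsarteClass_linear_comb hU hV hφ hψ ha hb hab,
      (hφint.const_mul a).add (hψint.const_mul b), ?_, ?_⟩
    · rw [integral_add (hφint.const_mul a) (hψint.const_mul b), integral_const_mul,
        integral_const_mul]
      calc C - 1 / ((n : ℝ) + 1)
          = a * (C - 1 / ((n : ℝ) + 1)) + b * (C - 1 / ((n : ℝ) + 1)) := by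
            rw [← add_mul, hab, one_mul]
        _ ≤ _ := by gcongr
    · filter_upwards [Lp.coeFn_add (a • x) (b • y), Lp.coeFn_smul a x, Lp.coeFn_smul b y, hx, hy]
        with z h1 h2 h3 h4 h5
      rw [h1, Pi.add_apply, h2, h3, Pi.smul_apply, Pi.smul_apply, h4, h5, smul_eq_mul, smul_eq_mul]
  have hAbdd : ∀ n, ∀ x ∈ A n, ‖x‖ ^ 2 ≤ 2 * μ.real U - C + 1 := by
    rintro n x ⟨φ, hφ, hint, hge, hx⟩
    have h1 : ‖x‖ ^ 2 = ∫ z, φ z ^ 2 ∂μ := by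
      rw [← real_inner_self_eq_norm_sq, L2.inner_def]
      refine integral_congr_ae ?_
      filter_upwards [hx] with z hz
      simp [hz]
    have h2 : 1 / ((n : ℝ) + 1) ≤ 1 := by
      rw [div_le_one (by positivity)]
      linarith [(Nat.cast_nonneg n : (0 : ℝ) ≤ n)]
    have h3 := integral_sq_le_of_mem_delsarteClass hU hV hUf hφ hint
    linarith
  obtain ⟨P, Ψ, hPA, hlim⟩ := exists_seq_tendsto_of_antitone_convex hA hAne hAconv hAbdd
  choose φ hφ hφint hφge hPφ using hPA
  obtain ⟨ψ, hψc, hψpd, hψK, hψ1, hψU, hψV, ns, hns, hae⟩ :=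
    exists_limit_of_tendsto_Lp hU hV hφ hPφ hlim
  have hClim : Tendsto (fun i : ℕ => C - 1 / ((ns i : ℝ) + 1)) atTop (𝓝 C) := by
    have := ((tendsto_one_div_add_atTop_nhds_zero_nat (𝕜 := ℝ)).comp hns.tendsto_atTop).const_sub C
    rwa [sub_zero] at this
  obtain ⟨hψint, hCψ⟩ := integrable_and_le_integral_of_tendsto hU hUf
    (fun i => delsarteClass_le_indicator hU hV (hφ (ns i))) (fun i => (hφ (ns i)).1)
    (fun i => hφint (ns i)) hψc hae (fun i => hφge (ns i)) hClim
  -- If `ψ 1 ≤ 0` then `|ψ| ≤ ψ 1` forces `ψ = 0`, contradicting `0 < C ≤ ∫ ψ`.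
  have hψpos : 0 < ψ 1 := by
    by_contra! hle
    have hzero : ∀ x, ψ x = 0 := fun x =>
      abs_nonpos_iff.1 ((hψpd.abs_apply_le x).trans hle)
    simp only [hzero, integral_zero] at hCψ
    exact absurd hCψ (not_le.2 hCpos)
  have hinv : 0 ≤ (ψ 1)⁻¹ := (inv_pos.2 hψpos).le
  refine ⟨fun x => (ψ 1)⁻¹ * ψ x, (mem_delsarteClass_iff hU hV).2
    ⟨by fun_prop, ?_, fun k hk k' hk' g => ?_, inv_mul_cancel₀ hψpos.ne', fun x hx => ?_,
      fun x hx => mul_nonneg hinv (hψV x hx)⟩, hψint.const_mul _, fun χ hχ hχint => ?_⟩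
  · simpa using hψpd.linear_comb hψpd hinv le_rfl
  · simp only [hψK k hk k' hk' g]
  · exact mul_nonpos_of_nonneg_of_nonpos hinv (hψU x hx)
  · rw [integral_const_mul]
    calc ∫ x, χ x ∂μ ≤ C := hle_C χ hχ hχint
      _ ≤ ∫ x, ψ x ∂μ := hCψ
      _ ≤ (ψ 1)⁻¹ * ∫ x, ψ x ∂μ :=
        le_mul_of_one_le_left (hCpos.le.trans hCψ) ((one_le_inv₀ hψpos).2 hψ1)

end Limit

end Delsarte

/-- The supremum defining the Delsarte constant is attained. The constant is positive because the
class contains a normalised autocorrelation, so an `L²` limit of a maximising sequence is non-zero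
and can be renormalised; amenability and the symmetry of `U` and `V` are not needed. -/
theorem mainTheorem1 {G : Type*} [Group G] [TopologicalSpace G] [IsTopologicalGroup G]
    [LocallyCompactSpace G] [T2Space G] [MeasurableSpace G] [BorelSpace G]
    (μ : Measure G) [μ.IsHaarMeasure] [μ.Regular] (hG : Delsarte.IsAmenable μ)
    (K : Subgroup G) (hK : IsCompact (K : Set G))
    (U V : Set G)
    (hU_closed : IsClosed U) (hU_inv : Delsarte.IsBiInvariantSet K U) (hU_symm : U⁻¹ = U)
    (hU_nhds : U ∈ nhds (1 : G)) (hU_fin : μ U < ∞)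
    (hV_closed : IsClosed V) (hV_inv : Delsarte.IsBiInvariantSet K V) (hV_symm : V⁻¹ = V) :
    ∃ φ ∈ Delsarte.delsarteClass K U V,
      Integrable φ μ ∧ ((∫ g, φ g ∂μ : ℝ) : EReal) = Delsarte.delsarteConstant μ K U V := by
  obtain ⟨φ, hφ, hint, hmax⟩ :=
    Delsarte.exists_integrable_maximizer hK hU_closed hU_inv hU_nhds hU_fin hV_closed
  refine ⟨φ, hφ, hint, le_antisymm ?_ (iSup₂_le fun ψ hψ =>
    Delsarte.extIntegral_le_of_forall_integrable hU_closed hV_closed hU_fin hmax hψ)⟩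
  rw [← Delsarte.extIntegral_eq_integral hint]
  exact le_iSup₂ (f := fun ψ (_ : ψ ∈ Delsarte.delsarteClass K U V) => Delsarte.extIntegral μ ψ)
    φ hφ
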